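/- **Combinatorial exchanges.** A combinatorial exchange with budget constraints consists of finite sets $I$ of buyers, $J$ of sellers and $K$ of indivisible items, each item being endowed to one seller; every buyer $i$ has a valuation $v_i(S)\ge 0$ of each package $S\subseteq K$ and a budget $B_i$, and every seller $j$ has a reservation value $v_j(Z)\ge 0$ of each package $Z\subseteq K$. An outcome consists of a package $S_i$ for each buyer, a package $Z_j$ supplied by each seller (either may be empty), and prices $p_i(S)\ge 0$, $p_j(Z)\ge 0$. It is feasible for a coalition $C\subseteq I\cup J$ if $p_i(S_i)\le\min\{B_i,v_i(S_i)\}$ for each buyer $i\in C$; $p_j(Z_j)\ge v_j(Z_j)$ and $Z_j$ contains only items endowed to $j$ for each seller $j\in C$; $\sum_{i\in C\cap I}p_i(S_i)=\sum_{j\in C\cap J}p_j(Z_j)$; and no item is assigned to more buyers in $C$ than there are sellers in $C$ supplying it. Payoffs are $v_i(S_i)-p_i(S_i)$ for buyers and $p_j(Z_j)-v_j(Z_j)$ for sellers. A core outcome is an outcome feasible for $I\cup J$ such that there is no nonempty coalition $C\subseteq I\cup J$ with an outcome feasible for $C$ that gives every member of $C$ a strictly higher payoff. Social welfare is $\sum_{i\in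 I}v_i(S_i)-\sum_{j\in J}v_j(Z_j)$. **The exchange $\mathrm{CEx}_\varphi$.** Let $n\ge 1$, $m,L\ge 0$, and let $\varphi(x,y)$ be a Boolean formula in disjunctive normal form in the variables $x_1,\dots,x_n,y_1,\dots,y_m$, with clauses $C_1,\dots,C_L$ (each a conjunction of a set of literals). Let $T,U,V,W$ be real numbers with $$0\le T<\tfrac1n,\qquad U>nL,\qquad V>4U,\qquad W>7nV.$$ Below, $i,i'$ range over $1,\dots,n$; $j$ over $1,\dots,m$; $l$ over $1,\dots,L$; and $k$ over $1,2$. *Sellers* (all reservation values are $0$): $S^\chi_i$ offers the items $\chi_i,\overline\chi_i$; $S^\psi_l$ offers the items $\psi_{lii'}$ for all $i,i'$; a single seller $S^{\gamma,\phi}$ offers the items $\gamma_j,\overline\gamma_j$ for all $j$ and $\phi_{li}$ for all $l,i$; a single seller $S^\lambda$ offers the items $\lambda^k_i,\overline\lambda^k_i$ for all $i,k$. *Bundles:* $\mathcal T^{\psi,\phi}_{li}=\{\psi_{li'i}: 1\le i'\le n\}\cup\{\phi_{li}\}$, $\ \mathcal F^\psi_{li}=\{\psi_{lii'}: 1\le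 i'\le n\}$, $\ \mathcal F^{\psi,\phi}_l=\{\psi_{lii'}: 1\le i,i'\le n\}\cup\{\phi_{li}: 1\le i\le n\}$. *Buyers* (with free disposal: a package is worth as much as the best wanted bundle that it contains, and $0$ if there is none): - $B^{\mathcal K}_i$: budget $V+T$; value $W$ for each of $\{\chi_i\}\cup\mathcal T^{\psi,\phi}_{li}$ and $\{\overline\chi_i\}\cup\mathcal T^{\psi,\phi}_{li}$, for all $l$. - $B^{\mathcal M}_i$: budget $2V$; value $2V$ for each of $\{\chi_i,\lambda^1_i,\lambda^2_i\}\cup\bigcup_{l:\,x_i\in C_l}\mathcal F^\psi_{li}$ and $\{\overline\chi_i,\overline\lambda^1_i,\overline\lambda^2_i\}\cup\bigcup_{l:\,\overline x_i\in C_l}\mathcal F^\psi_{li}$. - $B^{\chi,1}_i$ and $B^{\chi,2}_i$: budget $V$; value $V$ for each of $\chi_i$ and $\overline\chi_i$. - $B^{\lambda,1}_i$: budget $U$; value $V$ for $\lambda^1_i$ and $V-L$ for $\overline\lambda^1_i$. - $B^{\lambda,2}_i$: budget $U$; value $V-L$ for $\lambda^2_i$ and $V$ for $\overline\lambda^2_i$.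 - $B^{\mathcal G}_j$: budget $L$; the value of a package $S$ is the maximum of the number of $l$ with $\overline y_j\in C_l$ and $\{\gamma_j\}\cup\mathcal F^{\psi,\phi}_l\subseteq S$, and the number of $l$ with $y_j\in C_l$ and $\{\overline\gamma_j\}\cup\mathcal F^{\psi,\phi}_l\subseteq S$. **Theorem.** $\mathrm{CEx}_\varphi$ has a core outcome with social welfare at least $nW$ if and only if $\exists x\,\forall y\,\varphi(x,y)$ is true. -/

import Mathlib

/-! ### Combinatorial exchanges with financially constrained buyers -/

/-- A combinatorial exchange with buyers `I`, sellers `J` and indivisible items `K`: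
valuations and budgets of the buyers, valuations (reservation prices) of the sellers, and the
seller to whom each item is endowed. -/
structure Exchange (I J K : Type) where
  buyerValue : I → Finset K → ℝ
  budget : I → ℝ
  sellerValue : J → Finset K → ℝ
  owner : K → J

/-- An allocation (at most one package per bidder, `∅` meaning that the bidder does not trade)
together with non-linear personalized prices `p_i(S)`, `p_j(Z)`. -/
structure Outcome (I J K : Type) where
  /-- the package obtained by a buyer -/
  buys : I → Finset K
  /-- the package supplied by a seller -/
  sells : J → Finset K
  /-- the price that a buyer pays for a package -/
  buyerPrice : I → Finset K → ℝ
  /-- the payment that a seller receives for a package -/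
  sellerPrice : J → Finset K → ℝ

namespace Exchange

variable {I J K : Type} [DecidableEq K]

/-- Payoff `v_i(S) - p_i(S)` of a buyer. -/
def buyerPayoff (E : Exchange I J K) (o : Outcome I J K) (i : I) : ℝ :=
  E.buyerValue i (o.buys i) - o.buyerPrice i (o.buys i)

/-- Payoff `p_j(Z) - v_j(Z)` of a seller. -/
def sellerPayoff (E : Exchange I J K) (o : Outcome I J K) (j : J) : ℝ :=
  o.sellerPrice j (o.sells j) - E.sellerValue j (o.sells j)

/-- The outcome `o` can be realized within the coalition of the buyers in `A` and the sellers
in `B`, trading only among themselves (data of bidders outside the coalition are irrelevant). -/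
structure IsFeasible (E : Exchange I J K) (A : Finset I) (B : Finset J)
    (o : Outcome I J K) : Prop where
  buyerPrice_nonneg : ∀ i ∈ A, ∀ S, 0 ≤ o.buyerPrice i S
  sellerPrice_nonneg : ∀ j ∈ B, ∀ Z, 0 ≤ o.sellerPrice j Z
  /-- budget constraints and individual rationality of the buyers -/
  budget_constraint : ∀ i ∈ A, o.buyerPrice i (o.buys i) ≤
    min (E.budget i) (E.buyerValue i (o.buys i))
  /-- individual rationality of the sellers -/
  seller_rational : ∀ j ∈ B, E.sellerValue j (o.sells j) ≤ o.sellerPrice j (o.sells j)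
  /-- budget balance -/
  budget_balance : ∑ i ∈ A, o.buyerPrice i (o.buys i) = ∑ j ∈ B, o.sellerPrice j (o.sells j)
  /-- sellers supply only items endowed to them -/
  endowment : ∀ j ∈ B, ∀ k ∈ o.sells j, E.owner k = j
  /-- no item is assigned more often than it is supplied -/
  supply : ∀ k, (A.filter fun i => k ∈ o.buys i).card ≤ (B.filter fun j => k ∈ o.sells j).card

/-- The coalition of the buyers in `A` and the sellers in `B` blocks the outcome `o`: it is
nonempty, and trading among themselves its members can all be made strictly better off. -/
def Blocks (E : Exchange I J K) (o : Outcome I J K) (A : Finset I) (B : Finset J) : Prop :=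
  (A.Nonempty ∨ B.Nonempty) ∧ ∃ o' : Outcome I J K, E.IsFeasible A B o' ∧
    (∀ i ∈ A, E.buyerPayoff o i < E.buyerPayoff o' i) ∧
    (∀ j ∈ B, E.sellerPayoff o j < E.sellerPayoff o' j)

variable [Fintype I] [Fintype J]

/-- Core outcomes: feasible for the grand coalition and not blocked by any coalition. -/
def IsCore (E : Exchange I J K) (o : Outcome I J K) : Prop :=
  E.IsFeasible Finset.univ Finset.univ o ∧ ∀ A B, ¬ E.Blocks o A B

/-- Social welfare (gains from trade). -/
def welfare (E : Exchange I J K) (o : Outcome I J K) : ℝ :=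
  ∑ i, E.buyerValue i (o.buys i) - ∑ j, E.sellerValue j (o.sells j)

end Exchange

/-! ### Boolean formulas in disjunctive normal form -/

/-- A literal in the variables `x_1, …, x_n, y_1, …, y_m`: `(v, true)` is the variable `v` and
`(v, false)` is its negation. -/
abbrev Literal (n m : ℕ) : Type := (Fin n ⊕ Fin m) × Bool

/-- A formula in DNF with `L` clauses `C_1, …, C_L`, each a conjunction of literals. -/
abbrev DNF (n m L : ℕ) : Type := Fin L → Finset (Literal n m)

/-- The truth of `φ(x,y)`: all literals of some clause are true. -/
def DNF.Holds {n m L : ℕ} (φ : DNF n m L) (x : Fin n → Bool) (y : Fin m → Bool) : Prop :=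
  ∃ l, ∀ c ∈ φ l, Sum.elim x y c.1 = c.2

/-! ### The exchange built from a formula -/

namespace CEx

/-- The items; for `χ`, `γ`, `λ` the flag `true` stands for the plain item and `false` for the
barred item. -/
inductive Item (n m L : ℕ) : Type
  | chi (i : Fin n) (b : Bool)
  | psi (l : Fin L) (i i' : Fin n)
  | gamma (j : Fin m) (b : Bool)
  | phi (l : Fin L) (i : Fin n)
  | lam (k : Fin 2) (i : Fin n) (b : Bool)
  deriving DecidableEq

/-- The sellers `S^χ_i`, `S^ψ_l`, `S^{γ,φ}`, `S^λ`. -/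
inductive Seller (n L : ℕ) : Type
  | chi (i : Fin n)
  | psi (l : Fin L)
  | gammaPhi
  | lam
  deriving Fintype

/-- The buyers `B^K_i`, `B^M_i`, `B^{χ,1}_i` and `B^{χ,2}_i`, `B^{λ,1}_i`, `B^{λ,2}_i`,
`B^G_j`. -/
inductive Buyer (n m : ℕ) : Type
  | K (i : Fin n)
  | M (i : Fin n)
  | chi (k : Fin 2) (i : Fin n)
  | lam1 (i : Fin n)
  | lam2 (i : Fin n)
  | G (j : Fin m)
  deriving Fintype

variable {n m L : ℕ}

/-- The seller who offers an item. -/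
def owner : Item n m L → Seller n L
  | .chi i _ => .chi i
  | .psi l _ _ => .psi l
  | .gamma _ _ => .gammaPhi
  | .phi _ _ => .gammaPhi
  | .lam _ _ _ => .lam

/-- `{ψ_{l i' i} | i'} ∪ {φ_{l i}}`: one line of the matrix of clause `l`, and `φ_{l i}`. -/
def lineT (l : Fin L) (i : Fin n) : Finset (Item n m L) :=
  (Finset.univ.image fun i' => Item.psi l i' i) ∪ {Item.phi l i}

/-- `{ψ_{l i i'} | i'}`: one line, in the other direction, of the matrix of clause `l`. -/
def lineF (l : Fin L) (i : Fin n) : Finset (Item n m L) :=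
  Finset.univ.image fun i' => Item.psi l i i'

/-- `{ψ_{l i i'} | i, i'} ∪ {φ_{l i} | i}`: the whole matrix of clause `l`, and all its
`φ`-items. -/
def matrixF (l : Fin L) : Finset (Item n m L) :=
  (Finset.univ.image fun q : Fin n × Fin n => Item.psi l q.1 q.2) ∪
    Finset.univ.image fun i => Item.phi l i

/-- The bundles wanted by `B^K_i`. -/
def bundleK (i : Fin n) (b : Bool) (l : Fin L) : Finset (Item n m L) :=
  {Item.chi i b} ∪ lineT l i

/-- The bundles wanted by `B^M_i`: the lines belong to the clauses that contain the literal
`x_i` (for `b = true`), respectively its negation (for `b = false`). -/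
def bundleM (φ : DNF n m L) (i : Fin n) (b : Bool) : Finset (Item n m L) :=
  {Item.chi i b, Item.lam 0 i b, Item.lam 1 i b} ∪
    (Finset.univ.filter fun l => (Sum.inl i, b) ∈ φ l).biUnion fun l => lineF l i

/-- The bundles wanted by `B^G_j`; they matter for clauses that contain the negation of `y_j`
(for `b = true`), respectively `y_j` (for `b = false`). -/
def bundleG (j : Fin m) (b : Bool) (l : Fin L) : Finset (Item n m L) :=
  {Item.gamma j b} ∪ matrixF l

/-- The number of wanted bundles of `B^G_j` with sign `b` that are contained in `S`. -/
def countG (φ : DNF n m L) (j : Fin m) (b : Bool) (S : Finset (Item n m L)) : ℕ :=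
  (Finset.univ.filter fun l => (Sum.inr j, !b) ∈ φ l ∧ bundleG j b l ⊆ S).card

/-- The valuations of the buyers. -/
noncomputable def value (φ : DNF n m L) (V W : ℝ) : Buyer n m → Finset (Item n m L) → ℝ
  | .K i, S => if ∃ b l, bundleK i b l ⊆ S then W else 0
  | .M i, S => if ∃ b, bundleM φ i b ⊆ S then 2 * V else 0
  | .chi _ i, S => if ∃ b, Item.chi i b ∈ S then V else 0
  | .lam1 i, S =>
      if Item.lam 0 i true ∈ S then V else if Item.lam 0 i false ∈ S then V - L else 0
  | .lam2 i, S =>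
      if Item.lam 1 i false ∈ S then V else if Item.lam 1 i true ∈ S then V - L else 0
  | .G j, S => (max (countG φ j true S) (countG φ j false S) : ℕ)

/-- The budgets of the buyers; `L` is the number of clauses. -/
noncomputable def budget (L : ℕ) (T U V : ℝ) : Buyer n m → ℝ
  | .K _ => V + T
  | .M _ => 2 * V
  | .chi _ _ => V
  | .lam1 _ => U
  | .lam2 _ => U
  | .G _ => L

/-- The exchange `CEx_φ` with parameters `T, U, V, W`; the sellers have reservation value `0`. -/
noncomputable def exchange (φ : DNF n m L) (T U V W : ℝ) :
    Exchange (Buyer n m) (Seller n L) (Item n m L) where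
  buyerValue := value φ V W
  budget := budget L T U V
  sellerValue := fun _ _ => 0
  owner := owner

end CEx

/-! In the `ψ`-matrix of a clause `B^K_i` wants a column, `B^M_i` a row and `B^G_j` everything. A
row meets every column, so a matrix serves at most one of these three kinds of buyers. Since `W`
outweighs all other values together, welfare `nW` forces every `B^K_i` to obtain a bundle
(`exists_bundleK_subset`), and the `χ`-items they hold encode `x`.

Forward (`holds_of_isCore`): suppose some `y` falsifies `φ(x,y)`. Replace each `B^K_i` by a
`χ`-buyer who gets nothing; this loses at most `T` in payments per index. The matrices are now free:
those of clauses falsified by `x` go to the `B^M_i`, and all others, falsified by `y`, to the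
`B^G_j`. Before, at least one matrix was tied up by a `B^K_i`, so payments can rise by `1 > nT`; if
some `B^M_i` had no bundle, they can rise by even more. `Exchange.IsCore.sum_le` turns such a rise
into a blocking coalition.

Backward (`not_blocks_coreOutcome`): take `y` that falsifies as many clauses as possible. A
satisfied clause remains and its columns serve all `B^K_i`. Revenues are chosen so that the buyers
of a coalition can never pay more than the sellers they need already receive. Maximality of `y`
handles `S^{γ,φ}`. As to `S^λ`, which receives one unit less for every clause falsified by `x`,
either all `B^M_i` keep their side and need the `ψ`-sellers of exactly these clauses, or one of them
leaves or switches sides, which costs `V` or `L`. -/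

namespace Exchange

/-! ### Core outcomes of a general exchange. -/

open Classical in
/-- The set of items that a function `f` assigns to `i`. -/
noncomputable def fiber {X K : Type} [Fintype K] (f : K → X) (i : X) : Finset K :=
  Finset.univ.filter fun k => f k = i

@[simp] theorem mem_fiber {X K : Type} [Fintype K] {f : K → X} {i : X} {k : K} :
    k ∈ fiber f i ↔ f k = i := by
  simp [fiber]

variable {I J K : Type} [DecidableEq K] {E : Exchange I J K} {A : Finset I} {B : Finset J}
  {o : Outcome I J K}

theorem IsFeasible.owner_mem (h : E.IsFeasible A B o) {i : I} (hi : i ∈ A) {k : K}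
    (hk : k ∈ o.buys i) : E.owner k ∈ B := by
  have hpos : 0 < (A.filter fun i => k ∈ o.buys i).card :=
    Finset.card_pos.2 ⟨i, Finset.mem_filter.2 ⟨hi, hk⟩⟩
  obtain ⟨j, hj⟩ := Finset.card_pos.1 (hpos.trans_le (h.supply k))
  rw [Finset.mem_filter] at hj
  rw [h.endowment j hj.1 k hj.2]
  exact hj.1

/-- Only its owner can supply an item, so packages inside a coalition are disjoint. -/
theorem IsFeasible.eq_of_mem (h : E.IsFeasible A B o) {i i' : I} (hi : i ∈ A) (hi' : i' ∈ A)
    {k : K} (hk : k ∈ o.buys i) (hk' : k ∈ o.buys i') : i = i' := by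
  have hB : (B.filter fun j => k ∈ o.sells j).card ≤ 1 := by
    refine Finset.card_le_one.2 fun j hj j' hj' => ?_
    rw [Finset.mem_filter] at hj hj'
    rw [← h.endowment j hj.1 k hj.2, ← h.endowment j' hj'.1 k hj'.2]
  exact Finset.card_le_one.1 ((h.supply k).trans hB) i (Finset.mem_filter.2 ⟨hi, hk⟩) i'
    (Finset.mem_filter.2 ⟨hi', hk'⟩)

variable [Fintype K]

theorem supply_fiber [Fintype J] (E : Exchange I J K) (A : Finset I) (f : K → I) (k : K) :
    (A.filter fun i => k ∈ fiber f i).card ≤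
      (Finset.univ.filter fun j => k ∈ fiber E.owner j).card := by
  have h1 : (A.filter fun i => k ∈ fiber f i).card ≤ 1 := by
    refine Finset.card_le_one.2 fun i hi i' hi' => ?_
    rw [Finset.mem_filter, mem_fiber] at hi hi'
    rw [← hi.2, ← hi'.2]
  exact h1.trans (Finset.card_pos.2 ⟨E.owner k, by simp⟩)

/-- In a core outcome, the payments cannot be exceeded by what the buyers would be able to pay,
without a loss, for the packages of another assignment of all items. -/
theorem IsCore.sum_le [Fintype I] [Fintype J] [Nonempty J] (h : E.IsCore o)
    (hv : ∀ j Z, E.sellerValue j Z = 0) (f : K → I) (c : I → ℝ) (hc : ∀ i, 0 ≤ c i)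
    (hcb : ∀ i, c i ≤ E.budget i)
    (hcv : ∀ i, 0 < c i → c i ≤ E.buyerValue i (fiber f i) - E.buyerPayoff o i) :
    ∑ i, c i ≤ ∑ i, o.buyerPrice i (o.buys i) := by
  by_contra! hlt
  have hp : ∀ i, 0 ≤ E.buyerPayoff o i := fun i => by
    have := (h.1.budget_constraint i (Finset.mem_univ i)).trans (min_le_right _ _)
    unfold buyerPayoff
    linarith
  set P := ∑ i, o.buyerPrice i (o.buys i) with hP
  set C := ∑ i, c i with hC
  have hP0 : 0 ≤ P := Finset.sum_nonneg fun i _ => h.1.buyerPrice_nonneg i (Finset.mem_univ i) _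
  have hC0 : 0 < C := hP0.trans_lt hlt
  set t := (P + C) / (2 * C) with ht
  have htC : t * C = (P + C) / 2 := by rw [ht]; field_simp
  have ht0 : 0 ≤ t := by positivity
  have ht1 : t < 1 := by rw [ht, div_lt_one (by positivity)]; linarith
  have hJ : (0 : ℝ) < Fintype.card J := by exact_mod_cast Fintype.card_pos
  set d := (t * C - P) / Fintype.card J with hd
  have hd0 : 0 < d := div_pos (by linarith) hJ
  have hs : ∀ j, 0 ≤ o.sellerPrice j (o.sells j) := fun j =>
    h.1.sellerPrice_nonneg j (Finset.mem_univ j) _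
  have htc : ∀ i, t * c i ≤ c i := fun i => mul_le_of_le_one_left (hc i) ht1.le
  -- Buyers with `c i = 0` stay out of the coalition, as they could not be made strictly better off
  -- this way.
  refine h.2 (Finset.univ.filter fun i => 0 < c i) Finset.univ
    ⟨Or.inr Finset.univ_nonempty,
      ⟨fiber f, fiber E.owner, fun i _ => t * c i, fun j _ => o.sellerPrice j (o.sells j) + d⟩,
      ⟨?_, ?_, ?_, ?_, ?_, ?_, ?_⟩, ?_, ?_⟩
  · intro i _ _
    exact mul_nonneg ht0 (hc i)
  · intro j _ _
    exact add_nonneg (hs j) hd0.le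
  · intro i hi
    have hi := (Finset.mem_filter.1 hi).2
    refine le_min ((htc i).trans (hcb i)) ((htc i).trans ((hcv i hi).trans ?_))
    linarith [hp i]
  · intro j _
    simp only [hv]
    exact add_nonneg (hs j) hd0.le
  · have h1 : ∑ i ∈ Finset.univ.filter (fun i => 0 < c i), t * c i = t * C := by
      rw [hC, Finset.mul_sum, Finset.sum_filter]
      refine Finset.sum_congr rfl fun i _ => ?_
      split_ifs with hi
      · rfl
      · rw [le_antisymm (not_lt.1 hi) (hc i), mul_zero]
    have h2 : (Fintype.card J : ℝ) * d = t * C - P := by rw [hd]; field_simp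
    have h3 := h.1.budget_balance
    simp only [Finset.sum_add_distrib, Finset.sum_const, Finset.card_univ, nsmul_eq_mul]
    rw [h1, h2, ← h3, ← hP]
    ring
  · intro j _ k hk
    exact mem_fiber.1 hk
  · exact supply_fiber E _ f
  · intro i hi
    have hi := (Finset.mem_filter.1 hi).2
    have := hcv i hi
    have : t * c i < c i := mul_lt_of_lt_one_left hi ht1
    simp only [buyerPayoff] at *
    linarith
  · intro j _
    simp only [sellerPayoff, hv]
    linarith

end Exchange

namespace CEx

/-! ### Finiteness of the items, and sums over buyers and sellers. -/

variable {n m L : ℕ}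

instance : Fintype (Item n m L) :=
  Fintype.ofSurjective
    (fun s : (Fin n × Bool) ⊕ (Fin L × Fin n × Fin n) ⊕ (Fin m × Bool) ⊕ (Fin L × Fin n) ⊕
        (Fin 2 × Fin n × Bool) =>
      match s with
      | .inl (i, b) => Item.chi i b
      | .inr (.inl (l, i, i')) => Item.psi l i i'
      | .inr (.inr (.inl (j, b))) => Item.gamma j b
      | .inr (.inr (.inr (.inl (l, i)))) => Item.phi l i
      | .inr (.inr (.inr (.inr (k, i, b)))) => Item.lam k i b)
    (by
      intro k
      cases k with
      | chi i b => exact ⟨.inl (i, b), rfl⟩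
      | psi l i i' => exact ⟨.inr (.inl (l, i, i')), rfl⟩
      | gamma j b => exact ⟨.inr (.inr (.inl (j, b))), rfl⟩
      | phi l i => exact ⟨.inr (.inr (.inr (.inl (l, i)))), rfl⟩
      | lam k i b => exact ⟨.inr (.inr (.inr (.inr (k, i, b)))), rfl⟩)

instance : Nonempty (Seller n L) := ⟨.lam⟩

theorem sum_buyer (f : Buyer n m → ℝ) :
    ∑ a, f a = ∑ i, (f (.K i) + f (.M i) + f (.chi 0 i) + f (.chi 1 i)) +
      ∑ i, (f (.lam1 i) + f (.lam2 i)) + ∑ j, f (.G j) := by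
  let e : Fin n ⊕ Fin n ⊕ (Fin 2 × Fin n) ⊕ Fin n ⊕ Fin n ⊕ Fin m ≃ Buyer n m :=
    { toFun := fun s => match s with
        | .inl i => .K i
        | .inr (.inl i) => .M i
        | .inr (.inr (.inl q)) => .chi q.1 q.2
        | .inr (.inr (.inr (.inl i))) => .lam1 i
        | .inr (.inr (.inr (.inr (.inl i)))) => .lam2 i
        | .inr (.inr (.inr (.inr (.inr j)))) => .G j
      invFun := fun a => match a with
        | .K i => .inl i
        | .M i => .inr (.inl i)
        | .chi k i => .inr (.inr (.inl (k, i)))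
        | .lam1 i => .inr (.inr (.inr (.inl i)))
        | .lam2 i => .inr (.inr (.inr (.inr (.inl i))))
        | .G j => .inr (.inr (.inr (.inr (.inr j))))
      left_inv := by rintro (_ | _ | ⟨_, _⟩ | _ | _ | _) <;> rfl
      right_inv := by rintro (_ | _ | _ | _ | _ | _) <;> rfl }
  rw [← e.sum_comp]
  simp only [Fintype.sum_sum_type, Fintype.sum_prod_type, Fin.sum_univ_two,
    Finset.sum_add_distrib]
  change _ + (_ + (_ + _ + (_ + (_ + _)))) = _
  simp only [e, Equiv.coe_fn_mk]
  ring

theorem sum_seller (f : Seller n L → ℝ) :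
    ∑ a, f a = ∑ i, f (.chi i) + ∑ l, f (.psi l) + f .gammaPhi + f .lam := by
  let e : Fin n ⊕ Fin L ⊕ Unit ⊕ Unit ≃ Seller n L :=
    { toFun := fun s => match s with
        | .inl i => .chi i
        | .inr (.inl l) => .psi l
        | .inr (.inr (.inl _)) => .gammaPhi
        | .inr (.inr (.inr _)) => .lam
      invFun := fun a => match a with
        | .chi i => .inl i
        | .psi l => .inr (.inl l)
        | .gammaPhi => .inr (.inr (.inl ()))
        | .lam => .inr (.inr (.inr ()))
      left_inv := by rintro (_ | _ | _ | _) <;> rfl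
      right_inv := by rintro (_ | _ | _ | _) <;> rfl }
  rw [← e.sum_comp]
  simp only [Fintype.sum_sum_type, e, Equiv.coe_fn_mk, Finset.univ_unique, Finset.sum_singleton]
  ring

/-! ### Wanted bundles and the total value of the buyers `B^G_j`. -/

section Bundles

variable {S : Finset (Item n m L)}

theorem bundleK_subset {i : Fin n} {b : Bool} {l : Fin L} :
    bundleK i b l ⊆ S ↔
      Item.chi i b ∈ S ∧ (∀ i', Item.psi l i' i ∈ S) ∧ Item.phi l i ∈ S := by
  simp [bundleK, lineT, Finset.subset_iff, or_imp, forall_and]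
  tauto

theorem bundleM_subset {φ : DNF n m L} {i : Fin n} {b : Bool} :
    bundleM φ i b ⊆ S ↔
      Item.chi i b ∈ S ∧ Item.lam 0 i b ∈ S ∧ Item.lam 1 i b ∈ S ∧
        ∀ l, (Sum.inl i, b) ∈ φ l → ∀ i', Item.psi l i i' ∈ S := by
  simp only [bundleM, lineF, Finset.subset_iff, Finset.mem_union, Finset.mem_insert,
    Finset.mem_singleton, Finset.mem_biUnion, Finset.mem_filter, Finset.mem_univ, true_and,
    Finset.mem_image, or_imp, forall_and, forall_eq, forall_exists_index, and_imp, and_assoc]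
  refine and_congr_right fun _ => and_congr_right fun _ => and_congr_right fun _ => ?_
  exact ⟨fun h l hl i' => h _ l hl i' rfl, fun h k l hl i' e => e ▸ h l hl i'⟩

theorem bundleG_subset {j : Fin m} {b : Bool} {l : Fin L} :
    bundleG j b l ⊆ S ↔
      Item.gamma j b ∈ S ∧ (∀ i i', Item.psi l i i' ∈ S) ∧ ∀ i, Item.phi l i ∈ S := by
  simp only [bundleG, matrixF, Finset.subset_iff, Finset.mem_union, Finset.mem_singleton,
    Finset.mem_image, Finset.mem_univ, true_and, or_imp, forall_and, forall_eq,
    forall_exists_index, forall_apply_eq_imp_iff, Prod.forall]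
  exact and_congr_right fun _ => and_congr_left fun _ =>
    ⟨fun h i i' => h _ i i' rfl, fun h k i i' e => e ▸ h i i'⟩

/-- The total value that the buyers `B^G_j` attach to disjoint packages: every one of them
chooses a value of `y_j`, and the matrix of every clause is used at most once. -/
theorem exists_sum_value_G_le (hn : 1 ≤ n) (φ : DNF n m L) (V W : ℝ)
    (S : Fin m → Finset (Item n m L))
    (hS : ∀ j j' k, k ∈ S j → k ∈ S j' → j = j') :
    ∃ y : Fin m → Bool, ∑ j, value φ V W (.G j) (S j) ≤
      ((Finset.univ.filter fun l =>
        ∃ j, (Sum.inr j, !y j) ∈ φ l ∧ bundleG j (y j) l ⊆ S j).card : ℝ) := by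
  have hy : ∀ j, ∃ b, value φ V W (.G j) (S j) = countG φ j b (S j) := fun j => by
    rcases max_choice (countG φ j true (S j)) (countG φ j false (S j)) with h | h
    · exact ⟨true, by simp only [value, h]⟩
    · exact ⟨false, by simp only [value, h]⟩
  choose y hy using hy
  refine ⟨y, ?_⟩
  simp only [hy]
  rw [← Nat.cast_sum, Nat.cast_le]
  unfold countG
  rw [← Finset.card_biUnion]
  · refine Finset.card_le_card fun l hl => ?_
    simpa using hl
  · intro j _ j' _ hjj'
    refine Finset.disjoint_left.2 fun l hl hl' => hjj' ?_
    simp only [Finset.mem_filter, Finset.mem_univ, true_and, bundleG_subset] at hl hl'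
    -- Both packages would contain the first `φ`-item of clause `l`, which exists because `1 ≤ n`.
    exact hS j j' _ (hl.2.2.2 ⟨0, hn⟩) (hl'.2.2.2 ⟨0, hn⟩)

end Bundles

/-! ### Falsified clauses and the allocation attached to a truth assignment. -/

section Assignment

variable (φ : DNF n m L) (x : Fin n → Bool) (y : Fin m → Bool)

/-- The clauses that `x` falsifies. -/
def falseX : Finset (Fin L) :=
  Finset.univ.filter fun l => ∃ i, (Sum.inl i, !x i) ∈ φ l

/-- The clauses that `x` and `y` falsify. -/
def falseXY : Finset (Fin L) :=
  Finset.univ.filter fun l => (∃ i, (Sum.inl i, !x i) ∈ φ l) ∨ ∃ j, (Sum.inr j, !y j) ∈ φ l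

variable {φ x y} in
theorem mem_falseX {l : Fin L} : l ∈ falseX φ x ↔ ∃ i, (Sum.inl i, !x i) ∈ φ l := by
  simp [falseX]

variable {φ x y} in
theorem mem_falseXY {l : Fin L} :
    l ∈ falseXY φ x y ↔ l ∈ falseX φ x ∨ ∃ j, (Sum.inr j, !y j) ∈ φ l := by
  simp [falseX, falseXY]

theorem holds_iff : φ.Holds x y ↔ ∃ l, l ∉ falseXY φ x y := by
  unfold DNF.Holds
  refine exists_congr fun l => ?_
  simp only [mem_falseXY, mem_falseX, not_or, not_exists]
  constructor
  · intro h
    exact ⟨fun i hi => by simpa using h _ hi, fun j hj => by simpa using h _ hj⟩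
  · rintro ⟨h1, h2⟩ ⟨i | j, b⟩ hc
    · by_contra hb
      refine h1 i ?_
      rwa [show (!x i) = b by simpa using Bool.not_eq.2 hb]
    · by_contra hb
      refine h2 j ?_
      rwa [show (!y j) = b by simpa using Bool.not_eq.2 hb]

open Classical in
/-- A buyer `B^G_j` for every clause that is falsified by `y` and not by `x`. -/
noncomputable def clauseBuyer (l : Fin L) : Option (Fin m) :=
  if l ∈ falseX φ x then none
  else if h : ∃ j, (Sum.inr j, !y j) ∈ φ l then some h.choose else none

variable {φ x y} in
theorem clauseBuyer_some {l : Fin L} {j : Fin m} (h : clauseBuyer φ x y l = some j) :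
    l ∉ falseX φ x ∧ (Sum.inr j, !y j) ∈ φ l := by
  unfold clauseBuyer at h
  split_ifs at h with h1 h2
  refine ⟨h1, ?_⟩
  have := h2.choose_spec
  rwa [Option.some.inj h] at this

variable {φ x y} in
theorem clauseBuyer_none {l : Fin L} :
    clauseBuyer φ x y l = none ↔ l ∈ falseX φ x ∨ l ∉ falseXY φ x y := by
  unfold clauseBuyer
  rw [mem_falseXY]
  split_ifs with h1 h2
  · simp [h1]
  · simp [h1, h2]
  · simp only [h1, h2, or_self, not_false_iff, or_true]

/-- The clauses falsified by `y` but not by `x` are partitioned by their chosen buyer. -/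
theorem sum_card_clauseBuyer :
    ∑ j, ((Finset.univ.filter fun l => clauseBuyer φ x y l = some j).card : ℝ) =
      (falseXY φ x y).card - (falseX φ x).card := by
  classical
  have hsub : falseX φ x ⊆ falseXY φ x y := fun l hl => mem_falseXY.2 (Or.inl hl)
  rw [← Nat.cast_sum, ← Nat.cast_sub (Finset.card_le_card hsub), ← Finset.card_sdiff_of_subset hsub,
    ← Finset.card_biUnion]
  · congr 2
    ext l
    simp only [Finset.mem_biUnion, Finset.mem_univ, true_and, Finset.mem_filter, Finset.mem_sdiff]
    rw [← Option.isSome_iff_exists, ← Option.ne_none_iff_isSome, ne_eq, clauseBuyer_none]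
    tauto
  · intro j _ j' _ hjj'
    refine Finset.disjoint_left.2 fun l hl hl' => hjj' ?_
    simp only [Finset.mem_filter, Finset.mem_univ, true_and] at hl hl'
    exact Option.some.inj (hl.symm.trans hl')

open Classical in
/-- The buyer of every item in the allocation that belongs to `x` and `y`; `h i` obtains the item
`χ_i` or its barred variant, whichever is not used by `B^M_i`. -/
noncomputable def holder (h : Fin n → Buyer n m) : Item n m L → Buyer n m
  | .chi i b => if b = x i then h i else .M i
  | .psi l i i' => if l ∈ falseX φ x then .M i else
      (clauseBuyer φ x y l).elim (.K i') .G
  | .gamma j _ => .G j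
  | .phi l i => (clauseBuyer φ x y l).elim (.K i) .G
  | .lam k i b => if b = x i then (if k = 0 then .lam1 i else .lam2 i) else .M i

variable {V W : ℝ} (h : Fin n → Buyer n m)

open Exchange

theorem chi_mem_holder (i : Fin n) : Item.chi i (x i) ∈ fiber (holder φ x y h) (h i) := by
  simp [holder]

/-- A clause containing the literal that `x` makes false is falsified by `x`, and the allocation
gives row `i` of every such matrix to `B^M_i`. -/
theorem bundleM_subset_holder (i : Fin n) :
    bundleM φ i (!x i) ⊆ fiber (holder φ x y h) (.M i) := by
  rw [bundleM_subset]
  refine ⟨by simp [holder], by simp [holder], by simp [holder], fun l hl i' => ?_⟩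
  have : l ∈ falseX φ x := mem_falseX.2 ⟨i, hl⟩
  simp [holder, this]

theorem value_M_holder (i : Fin n) :
    value φ V W (.M i) (fiber (holder φ x y h) (.M i)) = 2 * V :=
  if_pos ⟨_, bundleM_subset_holder φ x y h i⟩

/-- One satisfied clause is enough for all `i` at once, since the columns of its matrix are
disjoint. -/
theorem bundleK_subset_holder {l : Fin L} (hl : l ∉ falseXY φ x y) (i : Fin n) :
    bundleK i (x i) l ⊆ fiber (holder φ x y .K) (.K i) := by
  have h1 : l ∉ falseX φ x := fun h => hl (mem_falseXY.2 (Or.inl h))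
  have h2 := clauseBuyer_none.2 (Or.inr hl)
  rw [bundleK_subset]
  exact ⟨by simp [holder], fun i' => by simp [holder, h1, h2], by simp [holder, h2]⟩

theorem lam1_mem_holder (i : Fin n) :
    Item.lam 0 i (x i) ∈ fiber (holder φ x y h) (.lam1 i) := by
  simp [holder]

theorem lam2_mem_holder (i : Fin n) :
    Item.lam 1 i (x i) ∈ fiber (holder φ x y h) (.lam2 i) := by
  simp [holder]

theorem card_le_value_G_holder (j : Fin m) :
    ((Finset.univ.filter fun l => clauseBuyer φ x y l = some j).card : ℝ) ≤
      value φ V W (.G j) (fiber (holder φ x y h) (.G j)) := by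
  have hle : (Finset.univ.filter fun l => clauseBuyer φ x y l = some j).card ≤
      countG φ j (y j) (fiber (holder φ x y h) (.G j)) := by
    refine Finset.card_le_card fun l hl => ?_
    simp only [Finset.mem_filter, Finset.mem_univ, true_and, bundleG_subset] at hl ⊢
    have hl' := clauseBuyer_some hl
    refine ⟨hl'.2, by simp [holder], fun i i' => by simp [holder, hl'.1, hl],
      fun i => by simp [holder, hl]⟩
  simp only [value, Nat.cast_le]
  refine hle.trans ?_
  cases y j
  · exact le_max_right _ _
  · exact le_max_left _ _

end Assignment

/-! ### Bounds on the valuations. -/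

section Values

variable {φ : DNF n m L} {V W : ℝ} {S : Finset (Item n m L)}

theorem value_K_le (hW : 0 ≤ W) (i : Fin n) : value φ V W (.K i) S ≤ W := by
  simp only [value]; split_ifs <;> simp [hW]

theorem value_M_le (hV : 0 ≤ V) (i : Fin n) : value φ V W (.M i) S ≤ 2 * V := by
  simp only [value]; split_ifs <;> linarith

theorem value_chi_le (hV : 0 ≤ V) (k : Fin 2) (i : Fin n) : value φ V W (.chi k i) S ≤ V := by
  simp only [value]; split_ifs <;> linarith

theorem value_lam1_le (hV : 0 ≤ V) (i : Fin n) : value φ V W (.lam1 i) S ≤ V := by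
  have : (0 : ℝ) ≤ L := L.cast_nonneg
  simp only [value]; split_ifs <;> linarith

theorem value_lam2_le (hV : 0 ≤ V) (i : Fin n) : value φ V W (.lam2 i) S ≤ V := by
  have : (0 : ℝ) ≤ L := L.cast_nonneg
  simp only [value]; split_ifs <;> linarith

theorem value_G_le (j : Fin m) : value φ V W (.G j) S ≤ L := by
  have h : ∀ b, countG φ j b S ≤ L := fun b => (Finset.card_le_univ _).trans (by simp)
  simp only [value, Nat.cast_le]
  exact max_le (h _) (h _)

theorem value_nonneg (hV : (L : ℝ) ≤ V) (hW : 0 ≤ W) (a : Buyer n m) : 0 ≤ value φ V W a S := by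
  have : (0 : ℝ) ≤ L := L.cast_nonneg
  cases a <;> simp only [value] <;> first | positivity | (split_ifs <;> linarith)

theorem value_lam1_mem {b : Bool} {i : Fin n} (h : Item.lam 0 i b ∈ S) :
    (if b then V else V - L) ≤ value φ V W (.lam1 i) S := by
  have : (0 : ℝ) ≤ L := L.cast_nonneg
  cases b <;> simp only [value, h] <;> split_ifs <;> simp_all

theorem value_lam2_mem {b : Bool} {i : Fin n} (h : Item.lam 1 i b ∈ S) :
    (if b then V - L else V) ≤ value φ V W (.lam2 i) S := by
  have : (0 : ℝ) ≤ L := L.cast_nonneg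
  cases b <;> simp only [value, h] <;> split_ifs <;> simp_all

/-- With `value_lam1_mem` this compares packages of which only the access to one of the two
`λ`-items is known; `L ≤ V` covers the package with neither item. -/
theorem value_lam1_notMem (hV : (L : ℝ) ≤ V) {b : Bool} {i : Fin n}
    (h : Item.lam 0 i (!b) ∉ S) :
    value φ V W (.lam1 i) S ≤ if b then V else V - L := by
  have hV0 : 0 ≤ V := L.cast_nonneg.trans hV
  cases b <;> simp only [value] <;> split_ifs <;> simp_all

theorem value_lam2_notMem (hV : (L : ℝ) ≤ V) {b : Bool} {i : Fin n}
    (h : Item.lam 1 i (!b) ∉ S) :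
    value φ V W (.lam2 i) S ≤ if b then V - L else V := by
  have hV0 : 0 ≤ V := L.cast_nonneg.trans hV
  cases b <;> simp only [value] <;> split_ifs <;> simp_all

end Values

/-! ### From a core outcome of high welfare to a witness `x`. -/

section Forward

variable {φ : DNF n m L} {T U V W : ℝ} {o : Outcome (Buyer n m) (Seller n L) (Item n m L)}

/-- If the social welfare is at least `nW`, then all buyers `B^K_i` obtain wanted bundles. -/
theorem exists_bundleK_subset (hn : 1 ≤ n) (hU : (n : ℝ) * L < U) (hV : 4 * U < V)
    (hW : 7 * n * V < W)
    (ho : (exchange φ T U V W).IsFeasible Finset.univ Finset.univ o)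
    (hw : (n : ℝ) * W ≤ (exchange φ T U V W).welfare o) (i : Fin n) :
    ∃ b l, bundleK i b l ⊆ o.buys (.K i) := by
  by_contra hi
  have hn' : (1 : ℝ) ≤ n := by exact_mod_cast hn
  have hL0 : (0 : ℝ) ≤ L := L.cast_nonneg
  have hLn : (L : ℝ) ≤ n * L := le_mul_of_one_le_left hL0 hn'
  have hV0 : 0 ≤ V := by linarith
  have hVn : V ≤ n * V := le_mul_of_one_le_left hV0 hn'
  have hW0 : 0 ≤ W := by linarith
  obtain ⟨y, hy⟩ := exists_sum_value_G_le hn φ V W (fun j => o.buys (.G j))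
    fun j j' k hk hk' => Buyer.G.inj
      (ho.eq_of_mem (Finset.mem_univ _) (Finset.mem_univ _) hk hk')
  have hG : ∑ j, value φ V W (.G j) (o.buys (.G j)) ≤ L := hy.trans <| by
    exact_mod_cast (Finset.card_le_univ _).trans (by simp)
  have h1 : ∀ i', value φ V W (.K i') (o.buys (.K i')) + value φ V W (.M i') (o.buys (.M i')) +
      value φ V W (.chi 0 i') (o.buys (.chi 0 i')) + value φ V W (.chi 1 i') (o.buys (.chi 1 i')) ≤
      W + 4 * V - if i' = i then W else 0 := fun i' => by
    have hK : value φ V W (.K i') (o.buys (.K i')) ≤ W - if i' = i then W else 0 := by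
      split_ifs with h
      · subst h
        rw [value, if_neg hi, sub_self]
      · rw [sub_zero]
        exact value_K_le hW0 i'
    linarith [value_M_le (φ := φ) (W := W) (S := o.buys (.M i')) hV0 i',
      value_chi_le (φ := φ) (W := W) (S := o.buys (.chi 0 i')) hV0 0 i',
      value_chi_le (φ := φ) (W := W) (S := o.buys (.chi 1 i')) hV0 1 i']
  have h2 : ∀ i', value φ V W (.lam1 i') (o.buys (.lam1 i')) +
      value φ V W (.lam2 i') (o.buys (.lam2 i')) ≤ 2 * V := fun i' => by
    linarith [value_lam1_le (φ := φ) (W := W) (S := o.buys (.lam1 i')) hV0 i',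
      value_lam2_le (φ := φ) (W := W) (S := o.buys (.lam2 i')) hV0 i']
  have h3 := Finset.sum_le_sum fun i' (_ : i' ∈ Finset.univ) => h1 i'
  have h4 := Finset.sum_le_sum fun i' (_ : i' ∈ Finset.univ) => h2 i'
  rw [Finset.sum_sub_distrib, Finset.sum_ite_eq' Finset.univ i, if_pos (Finset.mem_univ _)] at h3
  simp only [Finset.sum_const, Finset.card_univ, Fintype.card_fin, nsmul_eq_mul] at h3 h4
  simp only [Exchange.welfare, exchange, Finset.sum_const_zero, sub_zero] at hw
  rw [sum_buyer] at hw
  -- Losing one `W` is not made up by at most `4nV` from the `B^M_i` and `χ`-buyers, `2nV` from the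
  -- `λ`-buyers and `L < V` from the `B^G_j`.
  nlinarith

/-- If `∃ y, ¬φ(x,y)`, then a core outcome cannot give `χ_i` (for `x_i` true) or its barred variant
(for `x_i` false) to the buyers `B^K_i`. -/
theorem holds_of_isCore (hn : 1 ≤ n) (hT : T < 1 / (n : ℝ)) (hU : (n : ℝ) * L < U)
    (hV : 4 * U < V) (hW : 7 * n * V < W) (ho : (exchange φ T U V W).IsCore o) {x : Fin n → Bool}
    {l : Fin n → Fin L} (hx : ∀ i, bundleK i (x i) (l i) ⊆ o.buys (.K i)) (y : Fin m → Bool) :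
    φ.Holds x y := by
  classical
  by_contra hy
  have hall : falseXY φ x y = Finset.univ := by
    rw [holds_iff, not_exists] at hy
    exact Finset.eq_univ_of_forall fun l => not_not.1 (hy l)
  have hn' : (1 : ℝ) ≤ n := by exact_mod_cast hn
  have hL1 : (1 : ℝ) ≤ L := by exact_mod_cast (l ⟨0, hn⟩).pos
  have hLn : (L : ℝ) ≤ n * L := le_mul_of_one_le_left (by linarith) hn'
  have hV0 : 0 ≤ V := by linarith
  have hVn : V ≤ n * V := le_mul_of_one_le_left hV0 hn'
  have hW0 : 0 ≤ W := by linarith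
  have hnT : n * T < 1 := by
    rw [lt_div_iff₀ (by linarith)] at hT
    linarith
  have hinj : ∀ {a a' : Buyer n m} {k}, k ∈ o.buys a → k ∈ o.buys a' → a = a' :=
    fun hk hk' => ho.1.eq_of_mem (Finset.mem_univ _) (Finset.mem_univ _) hk hk'
  set p : Buyer n m → ℝ := fun a => o.buyerPrice a (o.buys a) with hp
  set v : Buyer n m → ℝ := fun a => value φ V W a (o.buys a) with hv
  have hp0 : ∀ a, 0 ≤ p a := fun a => ho.1.buyerPrice_nonneg a (Finset.mem_univ a) _
  have hpb : ∀ a, p a ≤ budget L T U V a := fun a =>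
    (ho.1.budget_constraint a (Finset.mem_univ a)).trans (min_le_left _ _)
  have hpv : ∀ a, p a ≤ v a := fun a =>
    (ho.1.budget_constraint a (Finset.mem_univ a)).trans (min_le_right _ _)
  -- The item on the side of `x i` is taken by `B^K_i`, so everyone else has to share the opposite
  -- one.
  have hchi : ∀ {a i b}, Item.chi i b ∈ o.buys a → a ≠ .K i → b = !x i := by
    intro a i b h hne
    by_contra hb
    rw [show b = x i by simpa using Bool.not_eq.2 hb] at h
    exact hne (hinj h (bundleK_subset.1 (hx i)).1)
  have hlose : ∀ i, ∃ κ : Fin 2, v (.chi κ i) = 0 := by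
    intro i
    by_contra! h
    have h' : ∀ κ : Fin 2, Item.chi i (!x i) ∈ o.buys (.chi κ i) := fun κ => by
      by_contra hκ
      refine h κ (if_neg ?_)
      rintro ⟨b, hb⟩
      exact hκ (hchi hb (by simp) ▸ hb)
    simpa using hinj (h' 0) (h' 1)
  choose κ hκ using hlose
  let won : Fin n → Prop := fun i => ∃ b, bundleM φ i b ⊆ o.buys (.M i)
  have hwon : ∀ {i}, won i → bundleM φ i (!x i) ⊆ o.buys (.M i) := by
    rintro i ⟨b, hb⟩
    exact hchi (bundleM_subset.1 hb).1 (by simp) ▸ hb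
  set f := holder φ x y (fun i => Buyer.chi (κ i) i) with hf
  set v' : Buyer n m → ℝ := fun a => value φ V W a (Exchange.fiber f a) with hv'
  -- What each buyer could pay in the new assignment without a loss: `B^K_i` is left out, the losing
  -- `χ`-buyer pays its full budget, and the `λ`-buyers repeat their old payments where `B^M_i`
  -- already had its bundle.
  let c : Buyer n m → ℝ := fun a => match a with
    | .K _ => 0
    | .M i => 2 * V - (v (.M i) - p (.M i))
    | .chi k i => if k = κ i then V else 0
    | .lam1 i => if won i then p (.lam1 i) else 0
    | .lam2 i => if won i then p (.lam2 i) else 0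
    | .G j => max 0 (v' (.G j) - (v (.G j) - p (.G j)))
  have hc : ∀ a, 0 ≤ c a := by
    rintro (i | i | ⟨k, i⟩ | i | i | j) <;> simp only [c]
    · exact le_rfl
    · have := value_M_le (φ := φ) (W := W) (S := o.buys (.M i)) hV0 i
      linarith [hp0 (.M i)]
    · split_ifs <;> simp [hV0]
    · split_ifs <;> simp [hp0]
    · split_ifs <;> simp [hp0]
    · exact le_max_left _ _
  have hcb : ∀ a, c a ≤ budget L T U V a := by
    have hU0 : 0 ≤ U := by linarith
    rintro (i | i | ⟨k, i⟩ | i | i | j) <;> simp only [c]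
    · have h1 := hpb (.K i)
      exact (hp0 _).trans h1
    · have := hpv (.M i)
      simp only [budget]
      linarith
    · simp only [budget]
      split_ifs <;> simp [hV0]
    · split_ifs
      · exact hpb _
      · exact hU0
    · split_ifs
      · exact hpb _
      · exact hU0
    · simp only [budget]
      refine max_le (by linarith) ?_
      have := value_G_le (φ := φ) (V := V) (W := W) (S := Exchange.fiber f (.G j)) j
      linarith [hpv (.G j)]
  have hcv : ∀ a, 0 < c a → c a ≤ v' a - (v a - p a) := by
    rintro (i | i | k | i | i | j) hpos <;> simp only [c] at hpos ⊢
    · exact absurd hpos (lt_irrefl _)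
    · simp only [hv', hf]
      rw [value_M_holder]
    · rename_i i
      split_ifs at hpos ⊢ with hk
      · subst hk
        have h1 : v' (.chi (κ i) i) = V :=
          if_pos ⟨_, chi_mem_holder φ x y (fun i => Buyer.chi (κ i) i) i⟩
        rw [h1, hκ]
        linarith [hp0 (.chi (κ i) i)]
      · exact absurd hpos (lt_irrefl _)
    · split_ifs at hpos ⊢ with hi
      · have h1 : Item.lam 0 i (!x i) ∉ o.buys (.lam1 i) := fun h => by
          simpa using hinj h (bundleM_subset.1 (hwon hi)).2.1
        have h2 := value_lam1_notMem (φ := φ) (V := V) (W := W) (by linarith) h1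
        have h3 := value_lam1_mem (φ := φ) (V := V) (W := W)
          (lam1_mem_holder φ x y (fun i => Buyer.chi (κ i) i) i)
        simp only [hv, hv', hf]
        linarith
      · exact absurd hpos (lt_irrefl _)
    · split_ifs at hpos ⊢ with hi
      · have h1 : Item.lam 1 i (!x i) ∉ o.buys (.lam2 i) := fun h => by
          simpa using hinj h (bundleM_subset.1 (hwon hi)).2.2.1
        have h2 := value_lam2_notMem (φ := φ) (V := V) (W := W) (by linarith) h1
        have h3 := value_lam2_mem (φ := φ) (V := V) (W := W)
          (lam2_mem_holder φ x y (fun i => Buyer.chi (κ i) i) i)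
        simp only [hv, hv', hf]
        linarith
      · exact absurd hpos (lt_irrefl _)
    · rcases max_choice 0 (v' (.G j) - (v (.G j) - p (.G j))) with h | h
      · rw [h] at hpos
        exact absurd hpos (lt_irrefl _)
      · exact h.le
  have hsum : ∑ a, c a ≤ ∑ a, p a := ho.sum_le (fun _ _ => rfl) f c hc hcb hcv
  rw [sum_buyer, sum_buyer, ← Finset.sum_add_distrib, ← Finset.sum_add_distrib] at hsum
  -- For each index the payment `V + T` of `B^K_i` is replaced by `V`, a loss of at most `T`. If
  -- `B^M_i` had no bundle, its new `2V` exceeds the at most `V` from the `χ`-buyers and `2U` from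
  -- the `λ`-buyers that may be lost.
  have hi : ∀ i, p (.K i) + p (.M i) + p (.chi 0 i) + p (.chi 1 i) + (p (.lam1 i) + p (.lam2 i)) -
      T + (if won i then 0 else V - 2 * U) ≤
      c (.K i) + c (.M i) + c (.chi 0 i) + c (.chi 1 i) + (c (.lam1 i) + c (.lam2 i)) := by
    intro i
    have hK : p (.K i) ≤ V + T := hpb _
    have hcc : c (.chi 0 i) + c (.chi 1 i) = V := by
      simp only [c]
      obtain h | h : κ i = 0 ∨ κ i = 1 := by omega
      · simp [h]
      · simp [h]
    by_cases h : won i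
    · have hM : v (.M i) = 2 * V := if_pos h
      have hcz : ∀ k : Fin 2, p (.chi k i) ≤ 0 := fun k => by
        refine (hpv _).trans (if_neg ?_).le
        rintro ⟨b, hb⟩
        have hb' := hchi hb (by simp)
        subst hb'
        simpa using hinj hb (bundleM_subset.1 (hwon h)).1
      have hcK : c (.K i) = 0 := rfl
      have hcM : c (.M i) = 2 * V - (v (.M i) - p (.M i)) := rfl
      have hl1 : c (.lam1 i) = p (.lam1 i) := if_pos h
      have hl2 : c (.lam2 i) = p (.lam2 i) := if_pos h
      rw [if_pos h]
      linarith [hcz 0, hcz 1]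
    · have hM : v (.M i) = 0 := if_neg h
      have hcz : p (.chi 0 i) + p (.chi 1 i) ≤ V := by
        have h0 : p (.chi 0 i) ≤ V := hpb _
        have h1 : p (.chi 1 i) ≤ V := hpb _
        have h2 := hpv (.chi (κ i) i)
        rw [hκ] at h2
        obtain h | h : κ i = 0 ∨ κ i = 1 := by omega
        · rw [h] at h2
          linarith
        · rw [h] at h2
          linarith
      have hcK : c (.K i) = 0 := rfl
      have hcM : c (.M i) = 2 * V - (v (.M i) - p (.M i)) := rfl
      have hl1 : p (.lam1 i) ≤ U := hpb _
      have hl2 : p (.lam2 i) ≤ U := hpb _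
      rw [if_neg h]
      linarith [hp0 (.M i), hc (.lam1 i), hc (.lam2 i)]
  have hi' := Finset.sum_le_sum fun i (_ : i ∈ Finset.univ) => hi i
  rw [Finset.sum_add_distrib, Finset.sum_sub_distrib] at hi'
  simp only [Finset.sum_const, Finset.card_univ, Fintype.card_fin, nsmul_eq_mul] at hi'
  have hG : ∑ j, v' (.G j) - ∑ j, v (.G j) + ∑ j, p (.G j) ≤ ∑ j, c (.G j) := by
    rw [← Finset.sum_sub_distrib, ← Finset.sum_add_distrib]
    refine Finset.sum_le_sum fun j _ => ?_
    have : v' (.G j) - (v (.G j) - p (.G j)) ≤ c (.G j) := le_max_right _ _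
    linarith
  have hG' : (L : ℝ) - (falseX φ x).card ≤ ∑ j, v' (.G j) := by
    have h1 := sum_card_clauseBuyer φ x y
    rw [hall, Finset.card_univ, Fintype.card_fin] at h1
    rw [← h1]
    exact Finset.sum_le_sum fun j _ => card_le_value_G_holder φ x y _ j
  obtain ⟨y', hy'⟩ := exists_sum_value_G_le hn φ V W (fun j => o.buys (.G j))
    fun j j' k hk hk' => Buyer.G.inj (hinj hk hk')
  set D := Finset.univ.filter fun l =>
    ∃ j, (Sum.inr j, !y' j) ∈ φ l ∧ bundleG j (y' j) l ⊆ o.buys (.G j) with hD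
  change ∑ j, v (.G j) ≤ (D.card : ℝ) at hy'
  by_cases hw : ∀ i, won i
  · have hz : ∑ i, (if won i then 0 else V - 2 * U) = 0 :=
      Finset.sum_eq_zero fun i _ => if_pos (hw i)
    have hX : ∀ l ∈ falseX φ x, ∃ i, ∀ i', Item.psi l i i' ∈ o.buys (.M i) := fun l hl => by
      obtain ⟨i, hi⟩ := mem_falseX.1 hl
      exact ⟨i, (bundleM_subset.1 (hwon (hw i))).2.2.2 l hi⟩
    set i₀ : Fin n := ⟨0, hn⟩
    have hl0 := (bundleK_subset.1 (hx i₀)).2.1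
    -- A matrix sold whole to some `B^G_j` has lost neither a row to a `B^M_i` nor a column to a
    -- `B^K_i`. So the clause used by the first `B^K_i` is counted neither in `D` nor among those
    -- falsified by `x`; this is the extra unit that beats `nT`.
    have hcard : D.card + (insert (l i₀) (falseX φ x)).card ≤ L := by
      rw [← Finset.card_union_of_disjoint]
      · exact (Finset.card_le_univ _).trans (by simp)
      · refine Finset.disjoint_left.2 fun l' h1 h2 => ?_
        obtain ⟨j, -, hj⟩ := (Finset.mem_filter.1 h1).2
        have hj := (bundleG_subset.1 hj).2.1
        rcases Finset.mem_insert.1 h2 with rfl | h2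
        · simpa using hinj (hj i₀ i₀) (hl0 i₀)
        · obtain ⟨i, hi⟩ := hX l' h2
          simpa using hinj (hj i i₀) (hi i₀)
    rw [Finset.card_insert_of_notMem fun h => ?_] at hcard
    · have hcard' : (D.card : ℝ) + ((falseX φ x).card + 1) ≤ L := by exact_mod_cast hcard
      linarith
    · obtain ⟨i, hi⟩ := hX _ h
      simpa using hinj (hl0 i) (hi i₀)
  · obtain ⟨i, hiw⟩ := not_forall.1 hw
    have hz : V - 2 * U ≤ ∑ i, (if won i then 0 else V - 2 * U) := by
      have := Finset.single_le_sum (f := fun i => if won i then 0 else V - 2 * U)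
        (fun i _ => by split_ifs <;> linarith) (Finset.mem_univ i)
      simpa only [if_neg hiw] using this
    have hDL : (D.card : ℝ) ≤ L := by exact_mod_cast (Finset.card_le_univ _).trans (by simp)
    have hFL : ((falseX φ x).card : ℝ) ≤ L := by
      exact_mod_cast (Finset.card_le_univ _).trans (by simp)
    -- Here `V - 2U > 2U` covers both `nT < 1` and the loss of at most `L` from the `B^G_j`.
    linarith

end Forward

/-! ### The core outcome attached to a witness `x`. -/

section Backward

variable {φ : DNF n m L} {T U V W : ℝ} {x : Fin n → Bool} {y : Fin m → Bool}

theorem value_empty (a : Buyer n m) : value φ V W a ∅ = 0 := by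
  cases a <;> simp [value, bundleK_subset, bundleM_subset, countG, bundleG_subset, -Finset.subset_empty]

/-- The payments of the buyers in the core outcome that belongs to `x` and `y`. -/
noncomputable def payment (φ : DNF n m L) (x : Fin n → Bool) (y : Fin m → Bool)
    (T U V : ℝ) : Buyer n m → ℝ
  | .K _ => V + T
  | .M _ => 2 * V
  | .chi _ _ => 0
  | .lam1 _ => U
  | .lam2 _ => U
  | .G j => (Finset.univ.filter fun l => clauseBuyer φ x y l = some j).card

open Classical in
/-- The revenues of the sellers in the core outcome that belongs to `x` and `y`. -/
noncomputable def revenue (φ : DNF n m L) (x : Fin n → Bool) (y : Fin m → Bool)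
    (T U V : ℝ) : Seller n L → ℝ
  | .chi _ => 2 * V
  | .psi l => if l ∈ falseX φ x then 1 else 0
  | .gammaPhi => (falseXY φ x y).card - (falseX φ x).card + n * T
  | .lam => n * V + 2 * n * U - (falseX φ x).card

/-- The core outcome that belongs to `x` and `y`. -/
noncomputable def coreOutcome (φ : DNF n m L) (x : Fin n → Bool) (y : Fin m → Bool)
    (T U V : ℝ) : Outcome (Buyer n m) (Seller n L) (Item n m L) where
  buys := Exchange.fiber (holder φ x y .K)
  sells := Exchange.fiber owner
  buyerPrice a _ := payment φ x y T U V a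
  sellerPrice s _ := revenue φ x y T U V s

theorem card_falseX_le_falseXY : (falseX φ x).card ≤ (falseXY φ x y).card :=
  Finset.card_le_card fun _ hl => mem_falseXY.2 (Or.inl hl)

theorem card_falseX_le : ((falseX φ x).card : ℝ) ≤ L := by
  exact_mod_cast (Finset.card_le_univ _).trans (by simp)

theorem sum_payment_eq :
    ∑ a, payment φ x y T U V a = ∑ s, revenue φ x y T U V s := by
  rw [sum_buyer, sum_seller]
  simp only [payment, revenue, Finset.sum_const, Finset.card_univ, Fintype.card_fin,
    nsmul_eq_mul, sum_card_clauseBuyer, Finset.sum_boole, Finset.filter_univ_mem]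
  ring

theorem revenue_nonneg (hn : 1 ≤ n) (hT0 : 0 ≤ T) (hU : (n : ℝ) * L < U) (hV : 4 * U < V)
    (s : Seller n L) : 0 ≤ revenue φ x y T U V s := by
  have hn' : (1 : ℝ) ≤ n := by exact_mod_cast hn
  have hL0 : (0 : ℝ) ≤ L := L.cast_nonneg
  have hLn : (L : ℝ) ≤ n * L := le_mul_of_one_le_left hL0 hn'
  cases s with
  | chi i => simp only [revenue]; linarith
  | psi l => simp only [revenue]; split_ifs <;> simp
  | gammaPhi =>
    have : ((falseX φ x).card : ℝ) ≤ (falseXY φ x y).card := by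
      exact_mod_cast card_falseX_le_falseXY (φ := φ) (x := x) (y := y)
    simp only [revenue]
    nlinarith
  | lam =>
    have := card_falseX_le (φ := φ) (x := x)
    simp only [revenue]
    nlinarith

theorem payment_nonneg (hT0 : 0 ≤ T) (hU : 0 ≤ U) (hV : 0 ≤ V) (a : Buyer n m) :
    0 ≤ payment φ x y T U V a := by
  cases a <;> simp only [payment] <;> positivity

theorem payment_le_budget (hV : 0 ≤ V) (a : Buyer n m) :
    payment φ x y T U V a ≤ budget L T U V a := by
  cases a with
  | G j => exact (card_le_value_G_holder (V := V) (W := V) φ x y .K j).trans (value_G_le j)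
  | chi k i => exact hV
  | _ => exact le_rfl

/-- The satisfied clause `l` provides the bundles of the `B^K_i`; the `λ`-buyers can afford `U` even
for their less valued item, because `U ≤ V - L`. -/
theorem payment_le_value (hn : 1 ≤ n) (hT : T < 1 / (n : ℝ)) (hU : (n : ℝ) * L < U)
    (hV : 4 * U < V) (hW : 7 * n * V < W) {l : Fin L} (hl : l ∉ falseXY φ x y) (a : Buyer n m) :
    payment φ x y T U V a ≤ value φ V W a (Exchange.fiber (holder φ x y .K) a) := by
  have hn' : (1 : ℝ) ≤ n := by exact_mod_cast hn
  have hL1 : (1 : ℝ) ≤ L := by exact_mod_cast l.pos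
  have hLn : (L : ℝ) ≤ n * L := le_mul_of_one_le_left (by linarith) hn'
  have hVn : V ≤ n * V := le_mul_of_one_le_left (by linarith) hn'
  have hT1 : T < 1 := hT.trans_le ((div_le_one (by linarith)).2 hn')
  cases a with
  | K i =>
    rw [value, if_pos ⟨_, _, bundleK_subset_holder φ x y hl i⟩]
    simp only [payment]
    linarith
  | M i => exact (value_M_holder φ x y .K i).ge
  | chi k i => exact value_nonneg (by linarith) (by linarith) _
  | lam1 i =>
    refine le_trans ?_ (value_lam1_mem (lam1_mem_holder φ x y .K i))
    simp only [payment]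
    split_ifs <;> linarith
  | lam2 i =>
    refine le_trans ?_ (value_lam2_mem (lam2_mem_holder φ x y .K i))
    simp only [payment]
    split_ifs <;> linarith
  | G j => exact card_le_value_G_holder φ x y .K j

theorem isFeasible_coreOutcome (hn : 1 ≤ n) (hT0 : 0 ≤ T) (hT : T < 1 / (n : ℝ))
    (hU : (n : ℝ) * L < U) (hV : 4 * U < V) (hW : 7 * n * V < W) {l : Fin L}
    (hl : l ∉ falseXY φ x y) :
    (exchange φ T U V W).IsFeasible Finset.univ Finset.univ (coreOutcome φ x y T U V) := by
  have hU0 : 0 ≤ U := le_trans (by positivity) hU.le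
  have hV0 : 0 ≤ V := by linarith
  exact
    { buyerPrice_nonneg := fun a _ _ => payment_nonneg hT0 hU0 hV0 a
      sellerPrice_nonneg := fun s _ _ => revenue_nonneg hn hT0 hU hV s
      budget_constraint := fun a _ =>
        le_min (payment_le_budget hV0 a) (payment_le_value hn hT hU hV hW hl a)
      seller_rational := fun s _ => revenue_nonneg hn hT0 hU hV s
      budget_balance := sum_payment_eq
      endowment := fun _ _ _ hk => Exchange.mem_fiber.1 hk
      supply := fun k => Exchange.supply_fiber (exchange φ T U V W) _ _ k }

theorem le_welfare_coreOutcome (hn : 1 ≤ n) (hU : (n : ℝ) * L < U) (hV : 4 * U < V)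
    (hW : 7 * n * V < W) {l : Fin L} (hl : l ∉ falseXY φ x y) :
    (n : ℝ) * W ≤ (exchange φ T U V W).welfare (coreOutcome φ x y T U V) := by
  have hn' : (1 : ℝ) ≤ n := by exact_mod_cast hn
  have hL0 : (0 : ℝ) ≤ L := L.cast_nonneg
  have hLn : (L : ℝ) ≤ n * L := le_mul_of_one_le_left hL0 hn'
  have hVn : V ≤ n * V := le_mul_of_one_le_left (by linarith) hn'
  have hnn : ∀ a : Buyer n m, 0 ≤ value φ V W a (Exchange.fiber (holder φ x y .K) a) :=
    fun a => value_nonneg (by linarith) (by linarith) a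
  simp only [Exchange.welfare, exchange, Finset.sum_const_zero, sub_zero, coreOutcome]
  have hK : ∀ i, value φ V W (.K i) (Exchange.fiber (holder φ x y .K) (.K i)) = W :=
    fun i => if_pos ⟨_, _, bundleK_subset_holder φ x y hl i⟩
  have hinj : Function.Injective (Buyer.K : Fin n → Buyer n m) := fun _ _ h => Buyer.K.inj h
  calc (n : ℝ) * W = ∑ i, value φ V W (.K i) (Exchange.fiber (holder φ x y .K) (.K i)) := by
        simp [hK]
    _ = ∑ a ∈ Finset.univ.map ⟨Buyer.K, hinj⟩,
          value φ V W a (Exchange.fiber (holder φ x y .K) a) := by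
        rw [Finset.sum_map]
        rfl
    _ ≤ _ := Finset.sum_le_sum_of_subset_of_nonneg (Finset.subset_univ _) fun a _ _ => hnn a

theorem sum_le_sub {ι : Type} [Fintype ι] {f : ι → ℝ} {c d : ℝ} (h : ∀ i, f i ≤ c) {i₀ : ι}
    (h₀ : f i₀ ≤ c - d) : ∑ i, f i ≤ Fintype.card ι * c - d := by
  classical
  calc ∑ i, f i ≤ ∑ i, (c - if i = i₀ then d else 0) := by
        refine Finset.sum_le_sum fun i _ => ?_
        split_ifs with hi
        · exact hi ▸ h₀
        · simpa using h i
    _ = _ := by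
        rw [Finset.sum_sub_distrib, Finset.sum_ite_eq' Finset.univ i₀]
        simp

/-- The payments of a coalition are charged to the sellers whose items they require. Of the `2V`
paid by `B^M_i`, half is charged to `S^χ_i` and half to `S^λ`; the extra `T` of `B^K_i` is charged
to `S^{γ,φ}`. -/
theorem not_blocks_coreOutcome (hn : 1 ≤ n) (hT0 : 0 ≤ T) (hT : T < 1 / (n : ℝ))
    (hU : (n : ℝ) * L < U) (hV : 4 * U < V) (hW : 7 * n * V < W) {l : Fin L}
    (hl : l ∉ falseXY φ x y) (hmax : ∀ y', (falseXY φ x y').card ≤ (falseXY φ x y).card)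
    (A : Finset (Buyer n m)) (B : Finset (Seller n L)) :
    ¬ (exchange φ T U V W).Blocks (coreOutcome φ x y T U V) A B := by
  classical
  rintro ⟨hne, o, ho, hA, hB⟩
  have hn' : (1 : ℝ) ≤ n := by exact_mod_cast hn
  have hL1 : (1 : ℝ) ≤ L := by exact_mod_cast l.pos
  have hLn : (L : ℝ) ≤ n * L := le_mul_of_one_le_left (by linarith) hn'
  have hU0 : 0 ≤ U := by linarith
  have hV0 : 0 ≤ V := by linarith
  have hVn : V ≤ n * V := le_mul_of_one_le_left hV0 hn'
  have hW0 : 0 ≤ W := by linarith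
  have hF := card_falseX_le (φ := φ) (x := x)
  have hinj : ∀ {a a' k}, a ∈ A → a' ∈ A → k ∈ o.buys a → k ∈ o.buys a' → a = a' :=
    fun ha ha' hk hk' => ho.eq_of_mem ha ha' hk hk'
  have hown : ∀ {a k}, a ∈ A → k ∈ o.buys a → owner k ∈ B := fun ha hk => ho.owner_mem ha hk
  set q : Buyer n m → ℝ := fun a => o.buyerPrice a (o.buys a) with hq
  set v : Buyer n m → ℝ := fun a => value φ V W a (o.buys a) with hv
  set w : Buyer n m → ℝ := fun a => value φ V W a (Exchange.fiber (holder φ x y .K) a) with hw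
  have hpay : ∀ a ∈ A, w a - payment φ x y T U V a < v a - q a := hA
  have hqb : ∀ a ∈ A, q a ≤ budget L T U V a := fun a ha =>
    (ho.budget_constraint a ha).trans (min_le_left _ _)
  have hpw : ∀ a, payment φ x y T U V a ≤ w a := payment_le_value hn hT hU hV hW hl
  have hq0 : ∀ a ∈ A, 0 ≤ q a := fun a ha => ho.buyerPrice_nonneg a ha _
  -- Payoffs in the core outcome are nonnegative, so a strict gain requires a package of positive
  -- value.
  have hvpos : ∀ a ∈ A, 0 < v a := fun a ha => by
    linarith [hpay a ha, hpw a, hq0 a ha]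
  have hBne : B.Nonempty := by
    rcases hne with ⟨a, ha⟩ | h
    · rcases (o.buys a).eq_empty_or_nonempty with h | ⟨k, hk⟩
      · have := hvpos a ha
        simp only [hv, h, value_empty, lt_irrefl] at this
      · exact ⟨_, hown ha hk⟩
    · exact h
  let r : Buyer n m → ℝ := fun a => if a ∈ A then q a else 0
  let u : Seller n L → ℝ := fun s => if s ∈ B then revenue φ x y T U V s else 0
  -- Budget balance turns the strict gains of the sellers into this inequality; the rest of the
  -- proof contradicts it.
  have hlt : ∑ s, u s < ∑ a, r a := by
    have h1 : ∑ s, u s = ∑ s ∈ B, revenue φ x y T U V s := by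
      simp only [u, Finset.sum_ite_mem, Finset.univ_inter]
    have h2 : ∑ a, r a = ∑ a ∈ A, q a := by
      simp only [r, Finset.sum_ite_mem, Finset.univ_inter]
    rw [h1, h2]
    refine lt_of_lt_of_eq (Finset.sum_lt_sum_of_nonempty hBne fun s hs => ?_)
      ho.budget_balance.symm
    simpa [Exchange.sellerPayoff, exchange, coreOutcome] using hB s hs
  have hrA : ∀ {a}, a ∈ A → r a = q a := fun ha => if_pos ha
  have hrN : ∀ {a}, a ∉ A → r a = 0 := fun ha => if_neg ha
  have hrb : ∀ {a} {c : ℝ}, budget L T U V a = c → r a ≤ if a ∈ A then c else 0 := by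
    intro a c hc
    split_ifs with ha
    · rw [hrA ha, ← hc]
      exact hqb a ha
    · rw [hrN ha]
  have hK : ∀ {i}, Buyer.K i ∈ A → ∃ b l, bundleK i b l ⊆ o.buys (.K i) := fun {i} hi => by
    by_contra h
    exact (hvpos _ hi).ne' (if_neg h)
  have hM : ∀ {i}, Buyer.M i ∈ A → ∃ b, bundleM φ i b ⊆ o.buys (.M i) := fun {i} hi => by
    by_contra h
    exact (hvpos _ hi).ne' (if_neg h)
  have hchi : ∀ {k i}, Buyer.chi k i ∈ A → ∃ b, Item.chi i b ∈ o.buys (.chi k i) :=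
    fun {k i} hi => by
      by_contra h
      exact (hvpos _ hi).ne' (if_neg h)
  -- the items of the sellers `S^χ_i`
  have hchis : ∀ i, r (.K i) + r (.M i) + r (.chi 0 i) + r (.chi 1 i) ≤
      u (.chi i) + (if Buyer.M i ∈ A then V else 0) + (if Buyer.K i ∈ A then T else 0) := by
    intro i
    have hitem : ∀ a ∈ A, a = .K i ∨ a = .M i ∨ a = .chi 0 i ∨ a = .chi 1 i →
        ∃ b, Item.chi i b ∈ o.buys a := by
      rintro a ha (rfl | rfl | rfl | rfl)
      · obtain ⟨b, l, h⟩ := hK ha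
        exact ⟨b, (bundleK_subset.1 h).1⟩
      · obtain ⟨b, h⟩ := hM ha
        exact ⟨b, (bundleM_subset.1 h).1⟩
      · exact hchi ha
      · exact hchi ha
    -- Pigeonhole: there are only two `χ`-items of index `i`.
    have hthree : ∀ a a' a'', (∃ b, Item.chi i b ∈ o.buys a) → (∃ b, Item.chi i b ∈ o.buys a') →
        (∃ b, Item.chi i b ∈ o.buys a'') → a ∈ A → a' ∈ A → a'' ∈ A →
        a = a' ∨ a = a'' ∨ a' = a'' := by
      rintro a a' a'' ⟨b, hb⟩ ⟨b', hb'⟩ ⟨b'', hb''⟩ ha ha' ha''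
      rcases (by decide : ∀ b b' b'' : Bool, b = b' ∨ b = b'' ∨ b' = b'') b b' b'' with rfl | rfl | rfl
      · exact Or.inl (hinj ha ha' hb hb')
      · exact Or.inr (Or.inl (hinj ha ha'' hb hb''))
      · exact Or.inr (Or.inr (hinj ha' ha'' hb' hb''))
    have hu : Buyer.K i ∈ A ∨ Buyer.M i ∈ A ∨ Buyer.chi 0 i ∈ A ∨ Buyer.chi 1 i ∈ A →
        u (.chi i) = 2 * V := by
      intro h
      refine if_pos ?_
      rcases h with h | h | h | h <;>
      · obtain ⟨b, hb⟩ := hitem _ h (by simp)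
        exact hown h hb
    have hu0 : 0 ≤ u (.chi i) := by
      simp only [u, revenue]
      split_ifs <;> linarith
    have n1 : ¬ (Buyer.K i ∈ A ∧ Buyer.M i ∈ A ∧ Buyer.chi 0 i ∈ A) := fun h => by
      simpa using hthree _ _ _ (hitem _ h.1 (by simp)) (hitem _ h.2.1 (by simp))
        (hitem _ h.2.2 (by simp)) h.1 h.2.1 h.2.2
    have n2 : ¬ (Buyer.K i ∈ A ∧ Buyer.M i ∈ A ∧ Buyer.chi 1 i ∈ A) := fun h => by
      simpa using hthree _ _ _ (hitem _ h.1 (by simp)) (hitem _ h.2.1 (by simp))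
        (hitem _ h.2.2 (by simp)) h.1 h.2.1 h.2.2
    have n3 : ¬ (Buyer.K i ∈ A ∧ Buyer.chi 0 i ∈ A ∧ Buyer.chi 1 i ∈ A) := fun h => by
      simpa using hthree _ _ _ (hitem _ h.1 (by simp)) (hitem _ h.2.1 (by simp))
        (hitem _ h.2.2 (by simp)) h.1 h.2.1 h.2.2
    have n4 : ¬ (Buyer.M i ∈ A ∧ Buyer.chi 0 i ∈ A ∧ Buyer.chi 1 i ∈ A) := fun h => by
      simpa using hthree _ _ _ (hitem _ h.1 (by simp)) (hitem _ h.2.1 (by simp))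
        (hitem _ h.2.2 (by simp)) h.1 h.2.1 h.2.2
    have r1 : r (.K i) ≤ if Buyer.K i ∈ A then V + T else 0 := hrb rfl
    have r2 : r (.M i) ≤ if Buyer.M i ∈ A then 2 * V else 0 := hrb rfl
    have r3 : r (.chi 0 i) ≤ if Buyer.chi 0 i ∈ A then V else 0 := hrb rfl
    have r4 : r (.chi 1 i) ≤ if Buyer.chi 1 i ∈ A then V else 0 := hrb rfl
    clear hitem hthree
    by_cases h1 : Buyer.K i ∈ A <;> by_cases h2 : Buyer.M i ∈ A <;>
    by_cases h3 : Buyer.chi 0 i ∈ A <;> by_cases h4 : Buyer.chi 1 i ∈ A <;>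
    simp only [h1, h2, h3, h4, if_true, if_false, or_true, or_false, and_true, and_false, not_true,
      not_false_iff, forall_const, false_imp_iff]
      at n1 n2 n3 n4 hu r1 r2 r3 r4 ⊢ <;>
    linarith
  -- the items of the seller `S^λ`
  have hlam1 : ∀ {i}, Buyer.lam1 i ∈ A → ∃ b, Item.lam 0 i b ∈ o.buys (.lam1 i) := fun {i} hi => by
    by_contra! h
    refine (hvpos _ hi).ne' ?_
    simp [hv, value, h]
  have hlam2 : ∀ {i}, Buyer.lam2 i ∈ A → ∃ b, Item.lam 1 i b ∈ o.buys (.lam2 i) := fun {i} hi => by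
    by_contra! h
    refine (hvpos _ hi).ne' ?_
    simp [hv, value, h]
  have hr1 : ∀ i, r (.lam1 i) ≤ U := fun i => (hrb rfl).trans (by
    split_ifs
    · exact le_rfl
    · exact hU0)
  have hr2 : ∀ i, r (.lam2 i) ≤ U := fun i => (hrb rfl).trans (by
    split_ifs
    · exact le_rfl
    · exact hU0)
  have hlamN : Seller.lam ∉ B → ∀ i, r (.lam1 i) + r (.lam2 i) = 0 := by
    intro h i
    rw [hrN fun hi => ?_, hrN fun hi => ?_, add_zero]
    · obtain ⟨b, hb⟩ := hlam2 hi
      exact h (hown hi hb)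
    · obtain ⟨b, hb⟩ := hlam1 hi
      exact h (hown hi hb)
  -- If `B^M_i` takes the side of `x i`, the `λ`-buyers are left with the other side. They rank the
  -- two sides oppositely, so exactly one of them held its preferred item in the core outcome and
  -- now has to be compensated by `L`.
  have hlams : ∀ i, Buyer.M i ∈ A → bundleM φ i (x i) ⊆ o.buys (.M i) →
      r (.lam1 i) + r (.lam2 i) ≤ 2 * U - L := by
    intro i hi hb
    have hb := bundleM_subset.1 hb
    have h1 : r (.lam1 i) ≤ U - if x i then (L : ℝ) else 0 := by
      by_cases ha : Buyer.lam1 i ∈ A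
      · have h1 : Item.lam 0 i (!(!x i)) ∉ o.buys (.lam1 i) := fun h => by
          rw [Bool.not_not] at h
          simpa using hinj ha hi h hb.2.1
        have h2 := value_lam1_notMem (φ := φ) (V := V) (W := W) (by linarith) h1
        have h3 := value_lam1_mem (φ := φ) (V := V) (W := W) (lam1_mem_holder φ x y .K i)
        have h4 := hpay _ ha
        simp only [hw, hv, payment] at h4
        have h5 := hr1 i
        rw [hrA ha] at h5 ⊢
        cases hxi : x i <;> simp only [hxi, Bool.not_true, Bool.not_false, if_true,
          Bool.false_eq_true, if_false] at h2 h3 ⊢ <;> linarith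
      · rw [hrN ha]
        split_ifs <;> linarith
    have h2 : r (.lam2 i) ≤ U - if x i then (0 : ℝ) else L := by
      by_cases ha : Buyer.lam2 i ∈ A
      · have h1 : Item.lam 1 i (!(!x i)) ∉ o.buys (.lam2 i) := fun h => by
          rw [Bool.not_not] at h
          simpa using hinj ha hi h hb.2.2.1
        have h2 := value_lam2_notMem (φ := φ) (V := V) (W := W) (by linarith) h1
        have h3 := value_lam2_mem (φ := φ) (V := V) (W := W) (lam2_mem_holder φ x y .K i)
        have h4 := hpay _ ha
        simp only [hw, hv, payment] at h4
        have h5 := hr2 i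
        rw [hrA ha] at h5 ⊢
        cases hxi : x i <;> simp only [hxi, Bool.not_true, Bool.not_false, if_true,
          Bool.false_eq_true, if_false] at h2 h3 ⊢ <;> linarith
      · rw [hrN ha]
        split_ifs <;> linarith
    split_ifs at h1 h2 <;> linarith
  -- the clauses that are sold to the buyers `B^G_j`
  obtain ⟨y', hy'⟩ := exists_sum_value_G_le hn φ V W
    -- Packages of buyers outside the coalition are arbitrary data and need not be disjoint, hence
    -- the default `∅`.
    (fun j => if Buyer.G j ∈ A then o.buys (.G j) else ∅) fun j j' k hk hk' => by
      split_ifs at hk hk' with h h'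
      · exact Buyer.G.inj (hinj h h' hk hk')
      all_goals simp at hk hk'
  set D := Finset.univ.filter fun l => ∃ j, (Sum.inr j, !y' j) ∈ φ l ∧
    bundleG j (y' j) l ⊆ if Buyer.G j ∈ A then o.buys (.G j) else ∅ with hD
  have hDG : ∀ l ∈ D, ∃ j, Buyer.G j ∈ A ∧ (Sum.inr j, !y' j) ∈ φ l ∧
      bundleG j (y' j) l ⊆ o.buys (.G j) := by
    intro l hl
    obtain ⟨j, hj, hsub⟩ := (Finset.mem_filter.1 hl).2
    split_ifs at hsub with h
    · exact ⟨j, h, hj, hsub⟩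
    · simpa using (bundleG_subset.1 hsub).1
  have hrG : ∑ j, r (.G j) ≤ D.card := by
    refine le_trans (Finset.sum_le_sum fun j _ => ?_) hy'
    split_ifs with h
    · rw [hrA h]
      exact (ho.budget_constraint _ h).trans (min_le_right _ _)
    · rw [hrN h]
      exact value_nonneg (by linarith) hW0 _
  set P := (falseX φ x).filter fun l => Seller.psi l ∈ B with hP
  have hDX : D ∩ falseX φ x ⊆ P := by
    intro l hl
    obtain ⟨hl1, hl2⟩ := Finset.mem_inter.1 hl
    obtain ⟨j, hj, -, hsub⟩ := hDG l hl1
    exact Finset.mem_filter.2 ⟨hl2, hown hj ((bundleG_subset.1 hsub).2.1 ⟨0, hn⟩ ⟨0, hn⟩)⟩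
  have hDX' : ((D ∩ falseX φ x).card : ℝ) ≤ P.card := by
    exact_mod_cast Finset.card_le_card hDX
  have hDcard : (D.card : ℝ) + ∑ i, (if Buyer.K i ∈ A then T else 0) ≤
      (D ∩ falseX φ x).card + u .gammaPhi := by
    by_cases hγ : Seller.gammaPhi ∈ B
    -- The clauses in `D` are falsified by `y'`, so maximality of `y` bounds those that `x` does not
    -- falsify already.
    · have h1 : (D \ falseX φ x).card + (falseX φ x).card ≤ (falseXY φ x y).card := by
        rw [← Finset.card_union_of_disjoint Finset.sdiff_disjoint]
        refine (Finset.card_le_card fun l hl => ?_).trans (hmax y')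
        rw [mem_falseXY]
        rcases Finset.mem_union.1 hl with hl | hl
        · obtain ⟨j, -, hj, -⟩ := hDG l (Finset.mem_sdiff.1 hl).1
          exact Or.inr ⟨j, hj⟩
        · exact Or.inl hl
      have h2 := Finset.card_sdiff_add_card_inter D (falseX φ x)
      have h1' : ((D \ falseX φ x).card : ℝ) + (falseX φ x).card ≤ (falseXY φ x y).card := by
        exact_mod_cast h1
      have h2' : ((D \ falseX φ x).card : ℝ) + (D ∩ falseX φ x).card = D.card := by
        exact_mod_cast h2
      have h3 : ∑ i : Fin n, (if Buyer.K i ∈ A then T else 0) ≤ n * T := by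
        refine (Finset.sum_le_card_nsmul _ _ T fun i _ => ?_).trans (by simp)
        split_ifs
        · exact le_rfl
        · exact hT0
      simp only [u, if_pos hγ, revenue]
      linarith
    · have h1 : D = ∅ := by
        refine Finset.eq_empty_of_forall_notMem fun l hl => hγ ?_
        obtain ⟨j, hj, -, hsub⟩ := hDG l hl
        exact hown hj (bundleG_subset.1 hsub).1
      have h2 : ∑ i : Fin n, (if Buyer.K i ∈ A then T else 0) = 0 := by
        refine Finset.sum_eq_zero fun i _ => if_neg fun hi => hγ ?_
        obtain ⟨b, l, hb⟩ := hK hi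
        exact hown hi (bundleK_subset.1 hb).2.2
      simp only [u, if_neg hγ, h1, h2]
      simp
  -- The discount of one unit per clause falsified by `x` in the revenue of `S^λ` must be absorbed:
  -- by the `ψ`-sellers counted in `P`, by the loss `L` when some `B^M_i` switches sides, or by the
  -- loss `V` when some `B^M_i` is absent.
  have hmain : ∑ i, (if Buyer.M i ∈ A then V else 0) + ∑ i, (r (.lam1 i) + r (.lam2 i)) +
      (D ∩ falseX φ x).card ≤ P.card + u .lam := by
    by_cases hlamB : Seller.lam ∈ B
    · have hu : u .lam = n * V + 2 * n * U - (falseX φ x).card := if_pos hlamB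
      have hMV : ∀ i, (if Buyer.M i ∈ A then V else 0) ≤ V := fun i => by
        split_ifs
        · exact le_rfl
        · exact hV0
      have hM0 : ∑ i : Fin n, (if Buyer.M i ∈ A then V else 0) ≤ n * V :=
        (Finset.sum_le_card_nsmul _ _ V fun i _ => hMV i).trans (by simp)
      have hl2 : ∀ i, r (.lam1 i) + r (.lam2 i) ≤ 2 * U := fun i => by linarith [hr1 i, hr2 i]
      have hl0 : ∑ i, (r (.lam1 i) + r (.lam2 i)) ≤ n * (2 * U) :=
        (Finset.sum_le_card_nsmul _ _ (2 * U) fun i _ => hl2 i).trans (by simp)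
      by_cases hall : ∀ i, Buyer.M i ∈ A
      · by_cases hb : ∃ i, bundleM φ i (x i) ⊆ o.buys (.M i)
        · obtain ⟨i, hi⟩ := hb
          have h1 := sum_le_sub hl2 (hlams i (hall i) hi)
          rw [Fintype.card_fin] at h1
          linarith
        · rw [not_exists] at hb
          have hb' : ∀ i, bundleM φ i (!x i) ⊆ o.buys (.M i) := fun i => by
            obtain ⟨b, h⟩ := hM (hall i)
            rwa [show (!x i) = b by
              by_contra hne
              exact hb i (by rwa [show x i = b by simpa using hne])]
          -- All `B^M_i` keep the side opposite to `x i`, so every matrix of a clause falsified by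
          -- `x` loses a row: its `ψ`-seller must be present and no `B^G_j` can use it.
          have hX : ∀ l ∈ falseX φ x, ∃ i, ∀ i', Item.psi l i i' ∈ o.buys (.M i) :=
            fun l hl => by
              obtain ⟨i, hi⟩ := mem_falseX.1 hl
              exact ⟨i, (bundleM_subset.1 (hb' i)).2.2.2 l hi⟩
          have hPX : P = falseX φ x := by
            refine Finset.filter_true_of_mem fun l hl => ?_
            obtain ⟨i, hi⟩ := hX l hl
            exact hown (hall i) (hi i)
          have hDe : D ∩ falseX φ x = ∅ := by
            refine Finset.eq_empty_of_forall_notMem fun l hl => ?_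
            obtain ⟨hl1, hl2⟩ := Finset.mem_inter.1 hl
            obtain ⟨j, hj, -, hsub⟩ := hDG l hl1
            obtain ⟨i, hi⟩ := hX l hl2
            simpa using hinj hj (hall i) ((bundleG_subset.1 hsub).2.1 i i) (hi i)
          rw [hPX, hDe, Finset.card_empty, Nat.cast_zero]
          linarith
      · obtain ⟨i, hi⟩ := not_forall.1 hall
        have h1 := sum_le_sub hMV (i₀ := i) (d := V) (by simp [hi])
        rw [Fintype.card_fin] at h1
        linarith
    · have hu : u .lam = 0 := if_neg hlamB
      have h1 : ∑ i : Fin n, (if Buyer.M i ∈ A then V else 0) = 0 := by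
        refine Finset.sum_eq_zero fun i _ => if_neg fun hi => hlamB ?_
        obtain ⟨b, hb⟩ := hM hi
        exact hown hi (bundleM_subset.1 hb).2.1
      have h2 : ∑ i, (r (.lam1 i) + r (.lam2 i)) = 0 :=
        Finset.sum_eq_zero fun i _ => hlamN hlamB i
      linarith
  have hpsi : ∑ l, u (.psi l) = P.card := by
    simp only [u, revenue, ← ite_and, Finset.sum_boole]
    congr 2
    ext l
    simp [hP, and_comm]
  have hsum := Finset.sum_le_sum fun i (_ : i ∈ Finset.univ) => hchis i
  rw [sum_seller, sum_buyer, hpsi] at hlt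
  simp only [Finset.sum_add_distrib] at hsum hlt hmain
  linarith

end Backward

end CEx

theorem mainTheorem2 (n m L : ℕ) (hn : 1 ≤ n) (φ : DNF n m L) (T U V W : ℝ)
    (hT0 : 0 ≤ T) (hT : T < 1 / (n : ℝ)) (hU : (n : ℝ) * L < U) (hV : 4 * U < V)
    (hW : 7 * n * V < W) :
    (∃ o : Outcome (CEx.Buyer n m) (CEx.Seller n L) (CEx.Item n m L),
        (CEx.exchange φ T U V W).IsCore o ∧
          (n : ℝ) * W ≤ (CEx.exchange φ T U V W).welfare o) ↔
      ∃ x : Fin n → Bool, ∀ y : Fin m → Bool, φ.Holds x y := by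
  constructor
  · rintro ⟨o, ho, hw⟩
    choose x l hx using CEx.exists_bundleK_subset hn hU hV hW ho.1 hw
    exact ⟨x, CEx.holds_of_isCore hn hT hU hV hW ho hx⟩
  · rintro ⟨x, hx⟩
    -- No coalition can sell more clauses to the `B^G_j` by passing to another `y` once the
    -- falsified ones are as many as possible.
    obtain ⟨y, hy⟩ := Finite.exists_max fun y : Fin m → Bool => (CEx.falseXY φ x y).card
    obtain ⟨l, hl⟩ := (CEx.holds_iff φ x y).1 (hx y)
    exact ⟨CEx.coreOutcome φ x y T U V,
      ⟨CEx.isFeasible_coreOutcome hn hT0 hT hU hV hW hl,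
        CEx.not_blocks_coreOutcome hn hT0 hT hU hV hW hl hy⟩,
      CEx.le_welfare_coreOutcome hn hU hV hW hl⟩
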